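/- Write $\binom{Y}{m}=\frac{1}{m!}\,Y(Y-1)\cdots(Y-m+1)$. For a polynomial $P\in\mathbb{Q}[X]$ of degree $d-1\ge 0$, its normalized Hilbert–Samuel coefficients $e_0,\dots,e_{d-1}$ are the unique rational numbers with $$P(X)=\sum_{i=0}^{d-1}(-1)^i e_i\binom{X+d-1-i}{d-1-i}.$$ Define polynomials $\sigma_j\in\mathbb{Q}[e_0,\dots,e_j]$, $j\ge 0$, recursively by $$\sigma_j=(-1)^j e_j-\sum_{k=0}^{j-1}(-1)^{j+k}\binom{\sigma_k+1}{j-k+1},$$ and, for $i\ge 1$, $$f_i=\sum_{k=0}^{i-2}(-1)^{i+k}\binom{\sigma_k+1}{i-k+1}-\binom{\sigma_{i-1}}{2}.$$ Then $f_i$ is a polynomial in $e_0,\dots,e_{i-1}$ only, and for every polynomial $P\neq 0$ of one of the types (a), (b), (c) below, with $d-1=\deg P$, one has $$(-1)^i e_i\ \ge\ f_i(e_0,\dots,e_{i-1})\qquad\text{for all } 1\le i\le d-1 .$$ In particular $e_1\le\binom{e_0}{2}$ if $d\ge 2$. (a) $P$ admits a Gotzmann development: there are integers $c_1\ge c_2\ge\dots\ge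 c_s\ge 0$ such that $P(n)=\sum_{i=1}^{s}\binom{n+c_i-(i-1)}{c_i}$ for all $n\gg 0$. (b) $P$ is the Hilbert polynomial of a standard $R_0$-algebra $S=\bigoplus_{n\ge0}S_n$ over an Artinian local ring $R_0$ that is equicharacteristic (it has the same characteristic as its residue field); that is, $S_0=R_0$, $S$ is generated as an $R_0$-algebra by the finitely generated $R_0$-module $S_1$, and $P(n)=\lambda_{R_0}(S_n)$ for all $n\gg 0$, where $\lambda$ denotes length. (c) $P$ is the Hilbert polynomial of an $\mathfrak m$-primary ideal $\mathfrak a$ of a Noetherian local ring $(A,\mathfrak m)$ such that $A/\mathfrak a$ is equicharacteristic; that is, $P(n)=\lambda_A(\mathfrak a^n/\mathfrak a^{n+1})$ for all $n\gg 0$. -/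

import Mathlib

namespace HilbertBounds

/-- A local ring is equicharacteristic if it has the same characteristic as its residue field.
The residue field is written as the quotient by the (unique) maximal ideal. -/
def IsEquicharacteristic (R : Type*) [CommRing R] : Prop :=
  ∀ M : Ideal R, M.IsMaximal → ringChar (R ⧸ M) = ringChar R

/-- `S = ⨁ₙ 𝒜 n` is a standard `R₀`-algebra: its degree zero part is `R₀`, its degree one part
is a finite `R₀`-module, and it is generated as an `R₀`-algebra in degree one. -/
structure IsStandardAlgebra (R₀ : Type*) {S : Type*} [CommRing R₀] [CommRing S] [Algebra R₀ S]
    (𝒜 : ℕ → Submodule R₀ S) [GradedAlgebra 𝒜] : Prop where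
  degree_zero : Function.Bijective (algebraMap R₀ (𝒜 0))
  finite_degree_one : Module.Finite R₀ (𝒜 1)
  generated : Algebra.adjoin R₀ (𝒜 1 : Set S) = ⊤

/-- The Hilbert function `n ↦ λ_{R₀}(S_n)`. The lengths are finite
for a standard algebra over an Artinian ring. -/
noncomputable def hilbertFunction (R₀ : Type*) {S : Type*} [CommRing R₀] [CommRing S]
    [Algebra R₀ S] (𝒜 : ℕ → Submodule R₀ S) (n : ℕ) : ℕ :=
  (Module.length R₀ (𝒜 n)).toNat

/-- The Hilbert function `n ↦ λ_A(𝔞ⁿ / 𝔞ⁿ⁺¹)` of an ideal. The lengths are finite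
for an ideal of a Noetherian local ring that is primary to the maximal ideal. -/
noncomputable def idealHilbertFunction {A : Type*} [CommRing A] (𝔞 : Ideal A) (n : ℕ) : ℕ :=
  (Module.length A (↥(𝔞 ^ n) ⧸ Submodule.submoduleOf (𝔞 ^ (n + 1)) (𝔞 ^ n))).toNat

/-- `P` is the Hilbert polynomial of the numerical function `H`: `P(n) = H(n)` for `n ≫ 0`. -/
def IsHilbertPolynomial (P : Polynomial ℚ) (H : ℕ → ℕ) : Prop :=
  ∀ᶠ n : ℕ in Filter.atTop, P.eval (n : ℚ) = (H n : ℚ)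

/-- `P` admits a Gotzmann development: there are `c₁ ≥ ⋯ ≥ c_s ≥ 0` with
`P(n) = ∑_{1 ≤ i ≤ s} binom (n + cᵢ - (i - 1)) cᵢ` for `n ≫ 0`; here the index is shifted to start
at `0`, the subtraction does not truncate for `n ≥ s`, and `s = 0` is the case `P = 0`. -/
def AdmitsGotzmannDevelopment (P : Polynomial ℚ) : Prop :=
  ∃ (s : ℕ) (c : Fin s → ℕ), Antitone c ∧
    ∀ᶠ n : ℕ in Filter.atTop,
      P.eval (n : ℚ) = ∑ i : Fin s, (((n + c i - (i : ℕ)).choose (c i) : ℕ) : ℚ)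

/-- `e₀, …, e_{d-1}` are the normalized Hilbert-Samuel coefficients of the polynomial `P` of degree
`d - 1`, that is, `P = ∑_{0 ≤ i ≤ d-1} (-1)ⁱ eᵢ binom (X + d - 1 - i) (d - 1 - i)`.
They are uniquely determined, and integers when `P` is integer-valued on large integers. -/
def IsHilbertSamuelCoeffs (P : Polynomial ℚ) (e : ℕ → ℚ) : Prop :=
  P = ∑ i ∈ Finset.range (P.natDegree + 1),
    Polynomial.C ((-1) ^ i * e i) *
      Ring.choose ((Polynomial.X : Polynomial ℚ) + ((P.natDegree - i : ℕ) : Polynomial ℚ))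
        (P.natDegree - i)

/-- The polynomials `σ_j` in the variables `e₀, …, e_j` (the `k`-th variable stands for `e_k`)
given by `σ_j = (-1)ʲ e_j - ∑_{k < j} (-1)ʲ⁺ᵏ binom (σ_k + 1) (j - k + 1)`. -/
noncomputable def sigma (j : ℕ) : MvPolynomial ℕ ℚ :=
  (-1) ^ j * MvPolynomial.X j -
    ∑ k : Fin j, (-1) ^ (j + (k : ℕ)) * Ring.choose (sigma k + 1) (j - (k : ℕ) + 1)
termination_by j
decreasing_by exact k.isLt

/-- The bounding polynomials
`fᵢ = ∑_{k < i - 1} (-1)ⁱ⁺ᵏ binom (σ_k + 1) (i - k + 1) - binom σ_{i-1} 2`, for `i ≥ 1`. -/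
noncomputable def boundPoly (i : ℕ) : MvPolynomial ℕ ℚ :=
  (∑ k ∈ Finset.range (i - 1), (-1) ^ (i + k) * Ring.choose (sigma k + 1) (i - k + 1)) -
    Ring.choose (sigma (i - 1)) 2

/-- The bounds `(-1)ⁱ eᵢ ≥ fᵢ(e₀, …, e_{i-1})` for all the coefficients `eᵢ`, `1 ≤ i ≤ deg P`,
and the bound `e₁ ≤ binom e₀ 2` when `deg P ≥ 1`. -/
def CoeffBounds (P : Polynomial ℚ) (e : ℕ → ℚ) : Prop :=
  (∀ i, 1 ≤ i → i ≤ P.natDegree → (-1) ^ i * e i ≥ MvPolynomial.eval e (boundPoly i)) ∧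
    (1 ≤ P.natDegree → e 1 ≤ Ring.choose (e 0) 2)

end HilbertBounds

/-! Everything reduces to Gotzmann developments. Let `c` be such a development of `P`, with largest
entry `D = deg P`, and let `t_k` be the number of `c_i ≥ D - k`. Expanding each term in the basis
`binom (X + j) j` expresses `(-1)^k e_k` as `t_k` plus a combination of binomials in `t_0, …,
t_{k-1}` (`sum_choose_eq_gotzmannCoeff`). This is the recursion defining `σ_k`, solved for `e_k`, so
`σ_k(e) = t_k` (`eval_sigma`). By Pascal's rule `σ_i - σ_{i-1} = (-1)^i e_i - f_i` (`sigma_succ`),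
so the bounds say exactly that `t_{i-1} ≤ t_i`, which is clear from counting.

It remains to find developments in the algebra and ideal cases. Order the monomials of degree `n` in
a finite set of generators lexicographically. Adding them one at a time writes the Hilbert function
as a sum over exponents `α` of the lengths of `R / leadIdeal α`, and these lengths decrease as `α`
grows (`leadIdeal_mono`). Slicing this weight by its values turns the sum into finitely many counts
of complements of monomial ideals.

Each complement is cut, up to finitely many monomials, into cones (translates of polynomial rings)
arranged in a standard way (`exists_isStandardFrom`). Repeated splitting leaves at most one cone in
each degree, with decreasing dimensions (`IsStandardFrom.exists_exact`). The cone with apex in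
degree `i` counts `binom (n - i + c_i) c_i` monomials, a term of a Gotzmann development. -/

namespace HilbertBounds

/-! ### Standard and exact families of cones -/

open Filter

/-- The number of degree `n` monomials of a cone with apex of degree `p.1` and dimension
`p.2 + 1` (for `n ≥ p.1`). -/
def coneCount (p : ℕ × ℕ) (n : ℕ) : ℕ := (n - p.1 + p.2).choose p.2

/-- The total count of a multiset of cones. -/
def coneSum (M : Multiset (ℕ × ℕ)) (n : ℕ) : ℕ := (M.map fun p => coneCount p n).sum

/-- A multiset of cones is standard from degree `q` if all apices have degree at least `q` and
below each cone there is a cone of at least the same dimension in every degree from `q` on. -/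
def IsStandardFrom (q : ℕ) (M : Multiset (ℕ × ℕ)) : Prop :=
  ∀ p ∈ M, q ≤ p.1 ∧ ∀ a, q ≤ a → a ≤ p.1 → ∃ p' ∈ M, p'.1 = a ∧ p.2 ≤ p'.2

/-- The positive-dimensional cones left after removing the apex of a cone. -/
def splitCone (p : ℕ × ℕ) : Multiset (ℕ × ℕ) :=
  (Multiset.range (p.2 + 1)).map fun k => (p.1 + 1, k)

/-- Split the cones with apex of degree `q`. -/
def splitAt (q : ℕ) (p : ℕ × ℕ) : Multiset (ℕ × ℕ) := if p.1 = q then splitCone p else {p}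

@[simp] lemma coneSum_zero (n : ℕ) : coneSum 0 n = 0 := rfl

@[simp] lemma coneSum_cons (p : ℕ × ℕ) (M : Multiset (ℕ × ℕ)) (n : ℕ) :
    coneSum (p ::ₘ M) n = coneCount p n + coneSum M n := by simp [coneSum]

@[simp] lemma coneSum_add (M N : Multiset (ℕ × ℕ)) (n : ℕ) :
    coneSum (M + N) n = coneSum M n + coneSum N n := by simp [coneSum]

lemma sum_range_choose_add (m c : ℕ) :
    ∑ k ∈ Finset.range (c + 1), (m + k).choose k = (m + 1 + c).choose c := by
  induction c with
  | zero => simp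
  | succ c ih =>
    rw [Finset.sum_range_succ, ih, show m + 1 + (c + 1) = m + 1 + c + 1 by ring,
      Nat.choose_succ_succ, show m + (c + 1) = m + 1 + c by ring]

/-- Sort the nonconstant monomials in `x_0, …, x_c` by the largest index `k` that occurs: they form
`x_k K[x_0, …, x_k]`, a cone with apex one degree higher. Only the apex itself is lost. -/
lemma coneSum_splitCone (p : ℕ × ℕ) {n : ℕ} (h : p.1 < n) :
    coneSum (splitCone p) n = coneCount p n := by
  have := sum_range_choose_add (n - (p.1 + 1)) p.2
  rw [show n - (p.1 + 1) + 1 = n - p.1 by omega] at this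
  rw [coneCount, ← this]
  simp only [coneSum, splitCone, Multiset.map_map, Finset.sum, Finset.range_val]
  rfl

lemma coneSum_bind_splitAt (q : ℕ) (M : Multiset (ℕ × ℕ)) {n : ℕ} (h : q < n) :
    coneSum (M.bind (splitAt q)) n = coneSum M n := by
  induction M using Multiset.induction with
  | empty => rfl
  | cons p M ih =>
    rw [Multiset.cons_bind, coneSum_add, coneSum_cons, ih, splitAt]
    split_ifs with hp
    · rw [coneSum_splitCone p (hp ▸ h)]
    · simp [coneSum]

/-- Exactly one piece of a split cone keeps its dimension. Hence setting aside one cone of top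
dimension and splitting the others lowers the number of top cones by one, which drives the induction
in `IsStandardFrom.exists_exact`. -/
lemma countP_splitAt (q d : ℕ) (p : ℕ × ℕ) (h : p.2 ≤ d) :
    (splitAt q p).countP (fun p => p.2 = d) = if p.2 = d then 1 else 0 := by
  unfold splitAt splitCone
  split_ifs with h1 h2 h2
  · subst h2
    rw [Multiset.countP_map]
    simp only [Multiset.filter_eq', Multiset.card_replicate]
    exact Multiset.count_eq_one_of_mem (Multiset.nodup_range _) (by simp)
  · rw [Multiset.countP_map, ← Multiset.countP_eq_card_filter, Multiset.countP_eq_zero]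
    intro a ha
    rw [Multiset.mem_range] at ha
    simp only
    omega
  · rw [Multiset.countP_eq_card.2 (by simpa using h2)]
    rfl
  · simpa [Multiset.countP_eq_zero] using h2

lemma countP_bind_splitAt (q d : ℕ) (M : Multiset (ℕ × ℕ)) (h : ∀ p ∈ M, p.2 ≤ d) :
    (M.bind (splitAt q)).countP (fun p => p.2 = d) = M.countP (fun p => p.2 = d) := by
  induction M using Multiset.induction with
  | empty => rfl
  | cons p M ih =>
    rw [Multiset.cons_bind, Multiset.countP_add, Multiset.countP_cons,
      ih fun r hr => h r (Multiset.mem_cons_of_mem hr),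
      countP_splitAt q d p (h p (Multiset.mem_cons_self p M)), add_comm]

lemma le_of_mem_splitAt {q : ℕ} {p r : ℕ × ℕ} (h : r ∈ splitAt q p) : r.2 ≤ p.2 := by
  unfold splitAt splitCone at h
  split_ifs at h with h1
  · obtain ⟨k, hk, rfl⟩ := Multiset.mem_map.1 h
    exact Nat.lt_succ_iff.1 (Multiset.mem_range.1 hk)
  · rw [Multiset.mem_singleton.1 h]

/-- New cones start at `q + 1`, where each is its own witness. For an untouched cone, the old
witnesses in degrees above `q` are neither split nor removed. -/
lemma IsStandardFrom.split {q d : ℕ} {M : Multiset (ℕ × ℕ)}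
    (h : IsStandardFrom q ((q, d) ::ₘ M)) :
    IsStandardFrom (q + 1) (M.bind (splitAt q)) := by
  intro r hr
  obtain ⟨p, hp, hr⟩ := Multiset.mem_bind.1 hr
  obtain ⟨hp1, hp2⟩ := h p (Multiset.mem_cons_of_mem hp)
  have hr' := hr
  unfold splitAt splitCone at hr
  split_ifs at hr with h1
  · obtain ⟨k, hk, rfl⟩ := Multiset.mem_map.1 hr
    refine ⟨by simp [h1], fun a ha ha' => ⟨_, Multiset.mem_bind.2 ⟨p, hp, hr'⟩, ?_, le_rfl⟩⟩
    simp only [h1] at ha' ⊢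
    omega
  · rw [Multiset.mem_singleton.1 hr]
    refine ⟨by omega, fun a ha ha' => ?_⟩
    obtain ⟨p', hp', hpa, hpp⟩ := hp2 a (by omega) ha'
    rcases Multiset.mem_cons.1 hp' with rfl | hp'
    · simp only at hpa
      omega
    · refine ⟨p', Multiset.mem_bind.2 ⟨p', hp', ?_⟩, hpa, hpp⟩
      rw [splitAt, if_neg (by omega)]
      exact Multiset.mem_singleton_self p'

/-- A standard multiset of cones can be made exact: at most one cone per degree, with decreasing
dimensions. -/
theorem IsStandardFrom.exists_exact (d : ℕ) : ∀ (q : ℕ) (M : Multiset (ℕ × ℕ)),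
    IsStandardFrom q M → (∀ p ∈ M, p.2 < d) →
    ∃ (s : ℕ) (c : Fin s → ℕ), Antitone c ∧ (∀ i, c i < d) ∧
      ∀ᶠ n in atTop, coneSum M n = ∑ i : Fin s, coneCount (q + i, c i) n := by
  induction d with
  | zero =>
    intro q M _ hd
    obtain rfl : M = 0 := Multiset.eq_zero_of_forall_notMem fun p hp => by simpa using hd p hp
    exact ⟨0, Fin.elim0, fun i => i.elim0, fun i => i.elim0, by simp⟩
  | succ d ih =>
    intro q M hM hd
    induction k : M.countP (fun p => p.2 = d) generalizing q M with
    | zero =>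
      rw [Multiset.countP_eq_zero] at k
      obtain ⟨s, c, h1, h2, h3⟩ := ih q M hM fun p hp =>
        lt_of_le_of_ne (Nat.lt_succ_iff.1 (hd p hp)) (k p hp)
      exact ⟨s, c, h1, fun i => (h2 i).trans (Nat.lt_succ_self d), h3⟩
    | succ k ihk =>
      obtain ⟨p, hp, hpd⟩ : ∃ p ∈ M, p.2 = d := Multiset.countP_pos.1 (by omega)
      -- Standardness puts a cone at least as large as `p` in degree `q`; since `d` is the top
      -- dimension, it is `(q, d)`. It becomes the first term, and all the others are pushed up to
      -- start from `q + 1`.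
      obtain ⟨p', hp', hq, hle⟩ := (hM p hp).2 q le_rfl (hM p hp).1
      have : p' = (q, d) := Prod.ext hq (by have := hd p' hp'; simp only; omega)
      subst this
      obtain ⟨M, rfl⟩ := Multiset.exists_cons_of_mem hp'
      have hd' : ∀ p ∈ M, p.2 ≤ d := fun p hp =>
        Nat.lt_succ_iff.1 (hd p (Multiset.mem_cons_of_mem hp))
      rw [Multiset.countP_cons_of_pos _ (by rfl)] at k
      obtain ⟨s, c, h1, h2, h3⟩ := ihk (q + 1) (M.bind (splitAt q)) hM.split (by
          intro r hr
          obtain ⟨p, hp, hr⟩ := Multiset.mem_bind.1 hr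
          exact Nat.lt_succ_iff.2 ((le_of_mem_splitAt hr).trans (hd' p hp)))
        (by rw [countP_bind_splitAt q d M hd']; omega)
      refine ⟨s + 1, Fin.cons d c, ?_, ?_, ?_⟩
      · intro i j hij
        cases j using Fin.cases with
        | zero => rw [Fin.le_zero_iff.1 hij]
        | succ j =>
          cases i using Fin.cases with
          | zero => simpa using Nat.lt_succ_iff.1 (h2 j)
          | succ i => simpa using h1 (Fin.succ_le_succ_iff.1 hij)
      · intro i
        cases i using Fin.cases with
        | zero => simp
        | succ i => simpa using h2 i
      · filter_upwards [h3, eventually_gt_atTop q] with n hn hqn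
        rw [coneSum_bind_splitAt q M hqn] at hn
        rw [coneSum_cons, hn, Fin.sum_univ_succ]
        simp [add_comm, add_left_comm]

end HilbertBounds

/-! ### Cone decompositions of complements of monomial ideals -/

namespace HilbertBounds

open Filter

/-- Along a strictly descending chain choose `a n` in `f n` but not in `f (n + 1)`. If `a m ≤ a n`
with `m < n`, then `a m` lies in `f n ≤ f (m + 1)`, a contradiction. For exponents this is Dickson's
lemma. -/
lemma wellFoundedLT_lowerSet {α : Type*} [Preorder α] [WellQuasiOrderedLE α] :
    WellFoundedLT (LowerSet α) := by
  refine ⟨wellFounded_iff_isEmpty_descending_chain.2 ⟨fun ⟨f, hf⟩ => ?_⟩⟩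
  have hex : ∀ n, ∃ a, a ∈ f n ∧ a ∉ f (n + 1) := fun n =>
    Set.not_subset.1 (not_le_of_gt (hf n))
  choose a ha ha' using hex
  obtain ⟨m, n, hmn, hle⟩ := wellQuasiOrdered_le (α := α) a
  have : f n ≤ f (m + 1) := antitone_nat_of_succ_le (fun k => (hf k).le) hmn
  exact ha' m ((f (m + 1)).lower hle (this (ha n)))

variable {σ : Type*} [Fintype σ] [DecidableEq σ]

open Classical in
/-- The number of exponents of degree `n` in a lower set. -/
noncomputable def degreeCount (N : LowerSet (σ →₀ ℕ)) (n : ℕ) : ℕ :=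
  ((Finset.univ.finsuppAntidiag n).filter (· ∈ N)).card

/-- The coordinate plane of `s` is contained in `N`. -/
def ContainsPlane (N : LowerSet (σ →₀ ℕ)) (s : Finset σ) : Prop :=
  ∀ α : σ →₀ ℕ, α.support ⊆ s → α ∈ N

/-- `s` spans a coordinate plane in `N` of the largest possible dimension. -/
def IsMaxPlane (N : LowerSet (σ →₀ ℕ)) (s : Finset σ) : Prop :=
  ContainsPlane N s ∧ ∀ t, ContainsPlane N t → t.card ≤ s.card

/-- The exponents in `N` not involving `i`. -/
def zeroSection (N : LowerSet (σ →₀ ℕ)) (i : σ) : LowerSet (σ →₀ ℕ) where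
  carrier := {α | α ∈ N ∧ α i = 0}
  lower' _ _ hle h := ⟨N.lower hle h.1, Nat.le_zero.1 (h.2 ▸ hle i)⟩

/-- The exponents that lie in `N` after multiplication by the `i`-th variable. -/
def shiftSection (N : LowerSet (σ →₀ ℕ)) (i : σ) : LowerSet (σ →₀ ℕ) where
  carrier := {α | α + Finsupp.single i 1 ∈ N}
  lower' α β hle h := N.lower (by gcongr : β + Finsupp.single i 1 ≤ _) h

omit [Fintype σ] [DecidableEq σ] in
lemma mem_shiftSection {N : LowerSet (σ →₀ ℕ)} {i : σ} {α : σ →₀ ℕ} :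
    α ∈ shiftSection N i ↔ α + Finsupp.single i 1 ∈ N := Iff.rfl

lemma degreeCount_succ (N : LowerSet (σ →₀ ℕ)) (i : σ) (n : ℕ) :
    degreeCount N (n + 1) = degreeCount (zeroSection N i) (n + 1) +
      degreeCount (shiftSection N i) n := by
  classical
  unfold degreeCount
  rw [← Finset.card_filter_add_card_filter_not (fun α : σ →₀ ℕ => α i = 0), Finset.filter_filter,
    Finset.filter_filter]
  refine congrArg₂ (· + ·) (congrArg _ (Finset.filter_congr fun _ _ => Iff.rfl)) ?_
  refine (Finset.card_bij (fun α _ => α + Finsupp.single i 1) ?_ ?_ ?_).symm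
  · intro α h
    simp only [Finset.mem_filter, Finset.mem_finsuppAntidiag, mem_shiftSection] at h ⊢
    refine ⟨⟨?_, Finset.subset_univ _⟩, h.2, by simp⟩
    simp [Finset.sum_add_distrib, h.1.1, Finsupp.single_apply]
  · intro α _ β _ h
    exact add_right_cancel h
  · intro β h
    simp only [Finset.mem_filter, Finset.mem_finsuppAntidiag] at h
    have hle : Finsupp.single i 1 ≤ β := by
      rw [Finsupp.single_le_iff]; omega
    refine ⟨β - Finsupp.single i 1, ?_, tsub_add_cancel_of_le hle⟩
    simp only [Finset.mem_filter, Finset.mem_finsuppAntidiag, mem_shiftSection,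
      tsub_add_cancel_of_le hle]
    refine ⟨⟨?_, Finset.subset_univ _⟩, h.2.1⟩
    have := h.1.1
    rw [← tsub_add_cancel_of_le hle] at this
    simpa [Finset.sum_add_distrib, Finsupp.single_apply] using this

omit [DecidableEq σ] in
lemma exists_isMaxPlane {N : LowerSet (σ →₀ ℕ)} (h : 0 ∈ N) : ∃ s, IsMaxPlane N s := by
  classical
  obtain ⟨s, hs, hmax⟩ := Finset.exists_max_image (Finset.univ.filter (ContainsPlane N))
    Finset.card ⟨∅, by
      simp only [Finset.mem_filter, Finset.mem_univ, true_and]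
      intro α hα
      rw [Finset.subset_empty, Finsupp.support_eq_empty] at hα
      rwa [hα]⟩
  exact ⟨s, (Finset.mem_filter.1 hs).2, fun t ht => hmax t (by simp [ht])⟩

omit [Fintype σ] [DecidableEq σ] in
lemma ContainsPlane.mono {N N' : LowerSet (σ →₀ ℕ)} (h : N ≤ N') {s : Finset σ}
    (hs : ContainsPlane N s) : ContainsPlane N' s := fun α hα => h (hs α hα)

omit [Fintype σ] [DecidableEq σ] in
lemma zeroSection_le (N : LowerSet (σ →₀ ℕ)) (i : σ) : zeroSection N i ≤ N := fun _ h => h.1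

omit [Fintype σ] [DecidableEq σ] in
lemma shiftSection_le (N : LowerSet (σ →₀ ℕ)) (i : σ) : shiftSection N i ≤ N :=
  fun _ h => N.lower (by simp) h

omit [Fintype σ] [DecidableEq σ] in
lemma add_single_mem_of_shiftSection_eq {N : LowerSet (σ →₀ ℕ)} {i : σ}
    (h : shiftSection N i = N) {α : σ →₀ ℕ} (hα : α ∈ N) (k : ℕ) :
    α + Finsupp.single i k ∈ N := by
  induction k with
  | zero => simpa using hα
  | succ k ih =>
    rw [← h, mem_shiftSection, add_assoc, ← Finsupp.single_add] at ih
    exact ih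

omit [Fintype σ] in
lemma ContainsPlane.insert {N : LowerSet (σ →₀ ℕ)} {s : Finset σ} {i : σ}
    (hs : ContainsPlane N s) (h : shiftSection N i = N) : ContainsPlane N (insert i s) := by
  intro α hα
  have := add_single_mem_of_shiftSection_eq h (hs (α.erase i) ?_) (α i)
  · rwa [Finsupp.erase_add_single] at this
  · rw [Finsupp.support_erase]
    intro j hj
    rw [Finset.mem_erase] at hj
    exact (Finset.mem_insert.1 (hα hj.2)).resolve_left hj.1

lemma degreeCount_plane {N : LowerSet (σ →₀ ℕ)} {s : Finset σ}
    (h : ∀ α, α ∈ N ↔ α.support ⊆ s) (n : ℕ) : degreeCount N n = (s.card + n - 1).choose n := by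
  classical
  rw [← Finset.card_finsuppAntidiag_nat_eq_choose]
  unfold degreeCount
  congr 1
  ext α
  simp only [Finset.mem_filter, Finset.mem_finsuppAntidiag, h]
  constructor
  · rintro ⟨⟨h1, -⟩, h2⟩
    exact ⟨by rwa [Finset.sum_subset (Finset.subset_univ s)
      (fun i _ hi => Finsupp.notMem_support_iff.1 fun h => hi (h2 h))], h2⟩
  · rintro ⟨h1, h2⟩
    exact ⟨⟨by rwa [← Finset.sum_subset (Finset.subset_univ s)
      (fun i _ hi => Finsupp.notMem_support_iff.1 fun h => hi (h2 h))], Finset.subset_univ _⟩, h2⟩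

/-- Shift all apices by one degree. -/
def shiftCones (M : Multiset (ℕ × ℕ)) : Multiset (ℕ × ℕ) := M.map fun p => (p.1 + 1, p.2)

lemma coneSum_shiftCones (M : Multiset (ℕ × ℕ)) (n : ℕ) :
    coneSum (shiftCones M) (n + 1) = coneSum M n := by
  simp [coneSum, shiftCones, coneCount]

/-- The complement of a proper monomial ideal has, up to finitely many exponents, a
decomposition into a standard multiset of cones. -/
theorem exists_isStandardFrom_of_zero_mem (N : LowerSet (σ →₀ ℕ)) : 0 ∈ N →
    ∃ M, IsStandardFrom 0 M ∧ (∀ᶠ n in atTop, degreeCount N n = coneSum M n) ∧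
      ∀ s, IsMaxPlane N s → (∀ p ∈ M, p.2 < s.card) ∧ (s.Nonempty → (0, s.card - 1) ∈ M) := by
  have := wellFoundedLT_lowerSet (α := σ →₀ ℕ)
  induction N using WellFoundedLT.induction with
  | ind N ih =>
  intro h0
  obtain ⟨s, hs, hmax⟩ := exists_isMaxPlane h0
  have hcard : ∀ t, IsMaxPlane N t → t.card = s.card := fun t ht =>
    le_antisymm (hmax t ht.1) (ht.2 s hs)
  by_cases hN : ∀ α ∈ N, α.support ⊆ s
  · replace hN : ∀ α, α ∈ N ↔ α.support ⊆ s := fun α => ⟨hN α, hs α⟩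
    rcases s.eq_empty_or_nonempty with rfl | hne
    · refine ⟨0, by simp [IsStandardFrom], ?_, ?_⟩
      -- Here `N` is the single exponent `0`, invisible in positive degrees, so no cone is needed.
      · filter_upwards [eventually_gt_atTop 0] with n hn
        rw [degreeCount_plane hN, Finset.card_empty, zero_add, Nat.choose_eq_zero_of_lt (by omega),
          coneSum_zero]
      · intro t ht
        have := hcard t ht
        rw [Finset.card_empty, Finset.card_eq_zero] at this
        simp [this]
    · have hpos := hne.card_pos
      refine ⟨{(0, s.card - 1)}, ?_, ?_, ?_⟩
      · intro p hp
        rw [Multiset.mem_singleton] at hp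
        subst hp
        exact ⟨le_rfl, fun a _ ha => ⟨_, Multiset.mem_singleton_self _,
          (Nat.le_zero.1 ha).symm, le_rfl⟩⟩
      · refine Eventually.of_forall fun n => ?_
        rw [degreeCount_plane hN]
        simp only [coneSum, coneCount, Multiset.map_singleton, Multiset.sum_singleton, Nat.sub_zero]
        rw [show s.card + n - 1 = n + (s.card - 1) by omega, Nat.choose_symm_add]
      · intro t ht
        rw [hcard t ht]
        simp [hpos]
  · push Not at hN
    obtain ⟨α, hα, hαs⟩ := hN
    -- Cut `N` along a variable outside the maximal plane `s`. Both sections are then strictly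
    -- smaller, and `zeroSection` still contains the plane of `s`.
    obtain ⟨i, hi, his⟩ := Finset.not_subset.1 hαs
    have hiN : Finsupp.single i 1 ∈ N := N.lower
      (Finsupp.single_le_iff.2 (Nat.one_le_iff_ne_zero.2 (Finsupp.mem_support_iff.1 hi))) hα
    have hlt0 : zeroSection N i < N := lt_of_le_of_ne (zeroSection_le N i) fun h => by
      rw [← h] at hiN
      simpa using hiN.2
    have hlt1 : shiftSection N i < N := lt_of_le_of_ne (shiftSection_le N i) fun h => by
      have := hmax _ (hs.insert h)
      rw [Finset.card_insert_of_notMem his] at this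
      omega
    have hs0 : IsMaxPlane (zeroSection N i) s :=
      ⟨fun β hβ => ⟨hs β hβ, Finsupp.notMem_support_iff.1 fun h => his (hβ h)⟩,
        fun t ht => hmax t (ht.mono hlt0.le)⟩
    have hz : (0 : σ →₀ ℕ) ∈ shiftSection N i := by simpa [mem_shiftSection] using hiN
    obtain ⟨M0, hM0, he0, hd0⟩ := ih _ hlt0 ⟨h0, rfl⟩
    obtain ⟨M1, hM1, he1, hd1⟩ := ih _ hlt1 hz
    obtain ⟨t, ht⟩ := exists_isMaxPlane hz
    have hts : t.card ≤ s.card := hmax t (ht.1.mono hlt1.le)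
    obtain ⟨hd0, hmem⟩ := hd0 s hs0
    replace hd1 : ∀ p ∈ M1, p.2 < s.card := fun p hp => ((hd1 t ht).1 p hp).trans_le hts
    refine ⟨M0 + shiftCones M1, ?_, ?_, ?_⟩
    · intro p hp
      refine ⟨Nat.zero_le _, fun a _ ha => ?_⟩
      rcases Multiset.mem_add.1 hp with hp | hp
      · obtain ⟨p', hp', h⟩ := (hM0 p hp).2 a (Nat.zero_le _) ha
        exact ⟨p', Multiset.mem_add.2 (.inl hp'), h⟩
      · obtain ⟨r, hr, rfl⟩ := Multiset.mem_map.1 hp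
        have hrs := hd1 r hr
        -- Shifted cones leave degree `0` empty; the cone `(0, s.card - 1)` of the zero section
        -- fills it and dominates them all. The claim about maximal planes is carried through the
        -- induction for this purpose.
        cases a with
        | zero =>
          exact ⟨_, Multiset.mem_add.2 (.inl (hmem (Finset.card_pos.1 (by omega)))), rfl, by
            simp only; omega⟩
        | succ a =>
          obtain ⟨p', hp', h1, h2⟩ := (hM1 r hr).2 a (Nat.zero_le _) (Nat.le_of_succ_le_succ ha)
          exact ⟨(p'.1 + 1, p'.2), Multiset.mem_add.2 (.inr (Multiset.mem_map.2 ⟨p', hp', rfl⟩)),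
            by simp [h1], h2⟩
    · obtain ⟨a, ha⟩ := eventually_atTop.1 he0
      obtain ⟨b, hb⟩ := eventually_atTop.1 he1
      refine eventually_atTop.2 ⟨a + b + 1, fun n hn => ?_⟩
      obtain ⟨n, rfl⟩ := Nat.exists_eq_succ_of_ne_zero (show n ≠ 0 by omega)
      rw [Nat.succ_eq_add_one, degreeCount_succ N i, coneSum_add, coneSum_shiftCones,
        ha _ (by omega), hb _ (by omega)]
    · intro t ht
      rw [← Finset.card_pos, hcard t ht]
      refine ⟨fun p hp => ?_, fun hpos => Multiset.mem_add.2 (.inl (hmem (Finset.card_pos.1 hpos)))⟩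
      rcases Multiset.mem_add.1 hp with hp | hp
      · exact hd0 p hp
      · obtain ⟨r, hr, rfl⟩ := Multiset.mem_map.1 hp
        exact hd1 r hr

theorem exists_isStandardFrom (N : LowerSet (σ →₀ ℕ)) :
    ∃ M, IsStandardFrom 0 M ∧ ∀ᶠ n in atTop, degreeCount N n = coneSum M n := by
  by_cases h : 0 ∈ N
  · obtain ⟨M, h1, h2, -⟩ := exists_isStandardFrom_of_zero_mem N h
    exact ⟨M, h1, h2⟩
  · classical
    refine ⟨0, by simp [IsStandardFrom], Eventually.of_forall fun n => ?_⟩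
    rw [degreeCount, coneSum_zero, Finset.card_eq_zero, Finset.filter_eq_empty_iff]
    exact fun α _ hα => h (N.lower zero_le hα)

lemma IsStandardFrom.add {q : ℕ} {M M' : Multiset (ℕ × ℕ)} (h : IsStandardFrom q M)
    (h' : IsStandardFrom q M') : IsStandardFrom q (M + M') := by
  intro p hp
  rcases Multiset.mem_add.1 hp with hp | hp
  · refine ⟨(h p hp).1, fun a ha ha' => ?_⟩
    obtain ⟨r, hr, h⟩ := (h p hp).2 a ha ha'
    exact ⟨r, Multiset.mem_add.2 (.inl hr), h⟩
  · refine ⟨(h' p hp).1, fun a ha ha' => ?_⟩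
    obtain ⟨r, hr, h⟩ := (h' p hp).2 a ha ha'
    exact ⟨r, Multiset.mem_add.2 (.inr hr), h⟩

lemma exists_isStandardFrom_sum (N : ℕ → LowerSet (σ →₀ ℕ)) (L : ℕ) :
    ∃ M, IsStandardFrom 0 M ∧
      ∀ᶠ n in atTop, ∑ j ∈ Finset.range L, degreeCount (N j) n = coneSum M n := by
  induction L with
  | zero => exact ⟨0, by simp [IsStandardFrom], by simp⟩
  | succ L ih =>
    obtain ⟨M, h1, h2⟩ := ih
    obtain ⟨M', h1', h2'⟩ := exists_isStandardFrom (N L)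
    refine ⟨M + M', h1.add h1', ?_⟩
    filter_upwards [h2, h2'] with n h h'
    rw [Finset.sum_range_succ, h, h', coneSum_add]

/-- The degree-wise sums of an antitone weight on exponents are eventually given by a Gotzmann
development. -/
theorem admitsGotzmannDevelopment_of_antitone {w : (σ →₀ ℕ) → ℕ} (hw : Antitone w)
    {P : Polynomial ℚ} {H : ℕ → ℕ} (hP : IsHilbertPolynomial P H)
    (hH : ∀ n, H n = ∑ α ∈ Finset.univ.finsuppAntidiag n, w α) :
    AdmitsGotzmannDevelopment P := by
  classical
  -- Slice by level sets: `w α` is the number of `j < w 0` with `α ∈ N j`, because `w` is largest at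
  -- `0`.
  let N : ℕ → LowerSet (σ →₀ ℕ) := fun j => ⟨{α | j < w α}, fun α β hle h => h.trans_le (hw hle)⟩
  obtain ⟨M, hM, he⟩ := exists_isStandardFrom_sum N (w 0)
  obtain ⟨d, hd⟩ : ∃ d, ∀ p ∈ M, p.2 < d := by
    refine ⟨(M.map Prod.snd).sum + 1, fun p hp => Nat.lt_succ_iff.2 ?_⟩
    exact Multiset.single_le_sum (fun _ _ => Nat.zero_le _) _ (Multiset.mem_map_of_mem _ hp)
  obtain ⟨s, c, hc, -, hsum⟩ := hM.exists_exact d 0 M hd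
  refine ⟨s, c, hc, ?_⟩
  filter_upwards [hP, he, hsum, eventually_ge_atTop s] with n h1 h2 h3 hn
  have key : H n = ∑ j ∈ Finset.range (w 0), degreeCount (N j) n := by
    simp only [degreeCount, Finset.card_filter]
    rw [Finset.sum_comm, hH]
    refine Finset.sum_congr rfl fun α _ => ?_
    rw [← Finset.card_filter, show (Finset.range (w 0)).filter (fun j => α ∈ N j) =
      Finset.range (w α) from ?_, Finset.card_range]
    ext j
    have : w α ≤ w 0 := hw zero_le
    have hj : α ∈ N j ↔ j < w α := Iff.rfl
    simp only [Finset.mem_filter, Finset.mem_range, hj]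
    omega
  rw [h1, key, h2, h3, Nat.cast_sum]
  refine Finset.sum_congr rfl fun i _ => ?_
  have := i.2
  rw [coneCount, show n - (0 + (i : ℕ), c i).1 + (0 + (i : ℕ), c i).2 = n + c i - i by
    simp only; omega]

end HilbertBounds

/-! ### Lengths as sums over monomials -/

namespace HilbertBounds

open Filter

section Length

variable {R V : Type*} [CommRing R] [AddCommGroup V] [Module R V]

/-- The quotient by `U` is cyclic on the class of `y`, whose annihilator is the displayed ideal. -/
lemma length_sup_span_singleton (U : Submodule R V) (y : V) :
    Module.length R ↥(U ⊔ Submodule.span R {y}) = Module.length R U +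
      Module.length R (R ⧸ U.comap (LinearMap.toSpanSingleton R V y)) := by
  set U' := U ⊔ Submodule.span R {y} with hU'
  have hy : y ∈ U' := Submodule.mem_sup_right (Submodule.mem_span_singleton_self y)
  let g : R →ₗ[R] ↥U' ⧸ U.submoduleOf U' :=
    (U.submoduleOf U').mkQ ∘ₗ LinearMap.toSpanSingleton R U' ⟨y, hy⟩
  have hg : Function.Surjective g := by
    intro z
    obtain ⟨⟨z, hz⟩, rfl⟩ := Submodule.mkQ_surjective _ z
    obtain ⟨u, hu, w, hw, rfl⟩ := Submodule.mem_sup.1 hz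
    obtain ⟨r, rfl⟩ := Submodule.mem_span_singleton.1 hw
    refine ⟨r, ?_⟩
    rw [← sub_eq_zero]
    simp only [g, LinearMap.comp_apply]
    rw [← map_sub, Submodule.mkQ_apply, Submodule.Quotient.mk_eq_zero, Submodule.submoduleOf, Submodule.mem_comap]
    simpa using hu
  have hker : LinearMap.ker g = U.comap (LinearMap.toSpanSingleton R V y) := by
    rw [LinearMap.ker_comp, Submodule.ker_mkQ]
    rfl
  rw [← hker, (g.quotKerEquivOfSurjective hg).length_eq]
  refine Module.length_eq_add_of_exact (Submodule.inclusion le_sup_left) (U.submoduleOf U').mkQ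
    (Submodule.inclusion_injective _) (Submodule.mkQ_surjective _) ?_
  rw [LinearMap.exact_iff, Submodule.ker_mkQ, Submodule.range_inclusion]
  rfl

lemma length_span_image {ι : Type*} [LinearOrder ι] (v : ι → V) (T : Finset ι) :
    Module.length R (Submodule.span R (v '' T)) = ∑ a ∈ T, Module.length R
      (R ⧸ (Submodule.span R (v '' {b | b ∈ T ∧ b < a})).comap
        (LinearMap.toSpanSingleton R V (v a))) := by
  induction T using Finset.induction_on_max with
  | empty => rw [Finset.coe_empty, Set.image_empty, Submodule.span_empty]; simp
  | insert a T ha ih =>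
    have haT : a ∉ T := fun h => lt_irrefl _ (ha a h)
    rw [Finset.sum_insert haT, Finset.coe_insert, Set.image_insert_eq, Submodule.span_insert,
      sup_comm, length_sup_span_singleton, ih, add_comm]
    congr 1
    · have : {b | b ∈ insert a T ∧ b < a} = (T : Set ι) := by
        ext b
        simp only [Finset.mem_insert, Set.mem_ofPred_eq, Finset.mem_coe]
        exact ⟨fun h => h.1.resolve_left h.2.ne, fun h => ⟨.inr h, ha b h⟩⟩
      rw [this]
    · refine Finset.sum_congr rfl fun c hc => ?_
      have : {b | b ∈ insert a T ∧ b < c} = {b | b ∈ T ∧ b < c} := by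
        ext b
        simp only [Finset.mem_insert, Set.mem_ofPred_eq]
        exact ⟨fun h => ⟨h.1.resolve_left (h.2.trans (ha c hc)).ne, h.2⟩, fun h => ⟨.inr h.1, h.2⟩⟩
      rw [this]

lemma length_quotient_submoduleOf (W U : Submodule R V) :
    Module.length R (↥U ⧸ W.submoduleOf U) = Module.length R (U.map W.mkQ) := by
  have hker : LinearMap.ker (W.mkQ ∘ₗ U.subtype) = W.submoduleOf U := by
    rw [LinearMap.ker_comp, Submodule.ker_mkQ]
    rfl
  have hrange : LinearMap.range (W.mkQ ∘ₗ U.subtype) = U.map W.mkQ := by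
    rw [LinearMap.range_comp, Submodule.range_subtype]
  rw [← hker, ← hrange]
  exact (LinearMap.quotKerEquivRange _).length_eq

end Length

section Monomials

variable {R S : Type*} [CommRing R] [CommRing S] [Algebra R S] {r : ℕ}

/-- The monomial in the elements `x i` with exponent `α`. -/
def monomialIn (x : Fin r → S) (α : Fin r →₀ ℕ) : S := α.prod fun i k => x i ^ k

@[simp] lemma monomialIn_zero (x : Fin r → S) : monomialIn x 0 = 1 := by simp [monomialIn]

lemma monomialIn_add (x : Fin r → S) (α β : Fin r →₀ ℕ) :
    monomialIn x (α + β) = monomialIn x α * monomialIn x β :=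
  Finsupp.prod_add_index' (by simp) (by simp [pow_add])

/-- The span of `W` and the monomials of the same degree that precede `α` lexicographically. -/
noncomputable def precedingSpan (x : Fin r → S) (W : ℕ → Submodule R S) (α : Fin r →₀ ℕ) : Submodule R S :=
  W α.degree ⊔ Submodule.span R
    (monomialIn x '' {β | β.degree = α.degree ∧ toLex β < toLex α})

/-- The coefficients `r` for which `r • x ^ α` is a combination of preceding monomials. -/
noncomputable def leadIdeal (x : Fin r → S) (W : ℕ → Submodule R S) (α : Fin r →₀ ℕ) : Ideal R :=
  (precedingSpan x W α).comap (LinearMap.toSpanSingleton R S (monomialIn x α))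

/-- The lexicographic order is compatible with addition, so multiplication by `x ^ γ` carries a
relation expressing `c • x ^ α` by preceding monomials to one for `c • x ^ (γ + α)`. -/
lemma leadIdeal_mono {x : Fin r → S} {W : ℕ → Submodule R S}
    (hW : ∀ (γ : Fin r →₀ ℕ) n, ∀ w ∈ W n, monomialIn x γ * w ∈ W (γ.degree + n)) :
    Monotone (leadIdeal x W) := by
  intro α β hle
  obtain ⟨γ, rfl⟩ := le_iff_exists_add'.1 hle
  have key : precedingSpan x W α ≤
      (precedingSpan x W (γ + α)).comap (LinearMap.mulLeft R (monomialIn x γ)) := by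
    refine sup_le (fun w hw => ?_) (Submodule.span_le.2 ?_)
    · refine Submodule.mem_sup_left ?_
      rw [map_add]
      exact hW γ _ w hw
    · rintro _ ⟨δ, ⟨h1, h2⟩, rfl⟩
      refine Submodule.mem_sup_right (Submodule.subset_span ⟨γ + δ, ⟨?_, ?_⟩, ?_⟩)
      · rw [map_add, map_add, h1]
      · rw [toLex_add, toLex_add]
        exact add_lt_add_right h2 _
      · rw [monomialIn_add, LinearMap.mulLeft_apply]
  intro c hc
  have := key hc
  simp only [leadIdeal, Submodule.mem_comap, LinearMap.toSpanSingleton_apply,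
    LinearMap.mulLeft_apply, monomialIn_add, mul_smul_comm] at this ⊢
  exact this

lemma mem_finsuppAntidiag_univ {n : ℕ} {α : Fin r →₀ ℕ} :
    α ∈ Finset.univ.finsuppAntidiag n ↔ α.degree = n := by
  rw [Finset.mem_finsuppAntidiag, Finsupp.degree_eq_sum]
  simp

lemma length_quotient_eq_sum_leadIdeal (x : Fin r → S) (W : ℕ → Submodule R S) (n : ℕ)
    (U : Submodule R S)
    (hU : U = W n ⊔ Submodule.span R (monomialIn x '' {β | β.degree = n})) :
    Module.length R (↥U ⧸ (W n).submoduleOf U) =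
      ∑ α ∈ Finset.univ.finsuppAntidiag n, Module.length R (R ⧸ leadIdeal x W α) := by
  let v : Lex (Fin r →₀ ℕ) → S ⧸ W n := fun α => (W n).mkQ (monomialIn x (ofLex α))
  have hmap : U.map (W n).mkQ = Submodule.span R
      (v '' (((Finset.univ.finsuppAntidiag n).map toLex.toEmbedding : Finset (Lex (Fin r →₀ ℕ))) :
        Set (Lex (Fin r →₀ ℕ)))) := by
    rw [hU, Submodule.map_sup, Submodule.mkQ_map_self, bot_sup_eq, Submodule.map_span,
      ← Set.image_comp]
    congr 1
    ext y
    simp only [Set.mem_image, Finset.coe_map, Finset.mem_coe, mem_finsuppAntidiag_univ,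
      Set.mem_ofPred_eq]
    constructor
    · rintro ⟨β, hβ, rfl⟩
      exact ⟨toLex β, ⟨β, hβ, rfl⟩, rfl⟩
    · rintro ⟨_, ⟨β, hβ, rfl⟩, rfl⟩
      exact ⟨β, hβ, rfl⟩
  rw [length_quotient_submoduleOf, hmap, length_span_image, Finset.sum_map]
  refine Finset.sum_congr rfl fun α hα => ?_
  rw [mem_finsuppAntidiag_univ] at hα
  suffices h : (Submodule.span R (v '' {b | b ∈ (Finset.univ.finsuppAntidiag n).map
      toLex.toEmbedding ∧ b < toLex α})).comap
        (LinearMap.toSpanSingleton R (S ⧸ W n) (v (toLex α))) = leadIdeal x W α by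
    exact congrArg (fun I : Ideal R => Module.length R (R ⧸ I)) h
  have himg : v '' {b | b ∈ (Finset.univ.finsuppAntidiag n).map toLex.toEmbedding ∧ b < toLex α} =
      (W n).mkQ '' (monomialIn x '' {β | β.degree = n ∧ toLex β < toLex α}) := by
    rw [← Set.image_comp]
    ext y
    simp only [Set.mem_image, Finset.mem_map, mem_finsuppAntidiag_univ, Set.mem_ofPred_eq]
    constructor
    · rintro ⟨_, ⟨⟨β, hβ, rfl⟩, hlt⟩, rfl⟩
      exact ⟨β, ⟨hβ, hlt⟩, rfl⟩
    · rintro ⟨β, ⟨hβ, hlt⟩, rfl⟩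
      exact ⟨toLex β, ⟨⟨β, hβ, rfl⟩, hlt⟩, rfl⟩
  rw [himg, ← Submodule.map_span]
  ext c
  rw [leadIdeal, precedingSpan, hα, ← Submodule.comap_map_mkQ]
  simp only [Submodule.mem_comap, LinearMap.toSpanSingleton_apply, map_smul]
  rfl

/-- Hilbert polynomials of filtrations generated by monomials in finitely many elements
admit Gotzmann developments. -/
theorem admitsGotzmannDevelopment_of_length (x : Fin r → S) (W U : ℕ → Submodule R S)
    (hW : ∀ (γ : Fin r →₀ ℕ) n, ∀ w ∈ W n, monomialIn x γ * w ∈ W (γ.degree + n))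
    (hU : ∀ n, U n = W n ⊔ Submodule.span R (monomialIn x '' {β | β.degree = n}))
    (hfin : Module.length R (R ⧸ (W 0).comap (Algebra.linearMap R S)) ≠ ⊤)
    {P : Polynomial ℚ} {H : ℕ → ℕ} (hP : IsHilbertPolynomial P H)
    (hH : ∀ n, H n = (Module.length R (↥(U n) ⧸ (W n).submoduleOf (U n))).toNat) :
    AdmitsGotzmannDevelopment P := by
  have hmono := leadIdeal_mono hW
  have hle : ∀ {I J : Ideal R}, I ≤ J → Module.length R (R ⧸ J) ≤ Module.length R (R ⧸ I) :=
    fun h => Module.length_le_of_surjective _ (Submodule.factor_surjective h)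
  -- Finite length is needed only at the exponent `0`: all other lead ideals are larger.
  have hzero : (W 0).comap (Algebra.linearMap R S) ≤ leadIdeal x W 0 := fun c hc => by
    refine Submodule.mem_sup_left ?_
    rw [map_zero, LinearMap.toSpanSingleton_apply, monomialIn_zero, ← Algebra.algebraMap_eq_smul_one]
    exact hc
  have hne : ∀ α, Module.length R (R ⧸ leadIdeal x W α) ≠ ⊤ := fun α =>
    ne_top_of_le_ne_top hfin (hle (hzero.trans (hmono zero_le)))
  refine admitsGotzmannDevelopment_of_antitone
    (w := fun α => (Module.length R (R ⧸ leadIdeal x W α)).toNat)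
    (fun α β h => ENat.toNat_le_toNat (hle (hmono h)) (hne α)) hP fun n => ?_
  rw [hH, length_quotient_eq_sum_leadIdeal x W n (U n) (hU n), ← ENat.natCast_inj,
    ENat.natCast_toNat (by simp [hne]), Nat.cast_sum]
  exact Finset.sum_congr rfl fun α _ => (ENat.natCast_toNat (hne α)).symm

end Monomials

end HilbertBounds

/-! ### Coefficients of a Gotzmann development -/

namespace HilbertBounds

open Filter Polynomial

/-- The polynomials `binom (X + j) j`, a sequence of polynomials of degrees `0, 1, 2, …`. -/
noncomputable def chooseBasis (j : ℕ) : ℚ[X] := Ring.choose ((X : ℚ[X]) + (j : ℚ[X])) j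

lemma degree_eval_ascPochhammer (j : ℕ) :
    ((ascPochhammer ℚ[X] j).eval (X + 1 : ℚ[X])).degree = j := by
  induction j with
  | zero => simp
  | succ j ih =>
    rw [ascPochhammer_succ_eval, degree_mul, ih, add_assoc,
      show (1 + (j : ℚ[X])) = C (1 + (j : ℚ)) by simp, degree_X_add_C, Nat.cast_succ]

lemma degree_chooseBasis (j : ℕ) : (chooseBasis j).degree = j := by
  have h := Ring.factorial_nsmul_multichoose_eq_ascPochhammer (X + 1 : ℚ[X]) j
  rw [Ring.multichoose_eq, Polynomial.ascPochhammer_smeval_eq_eval,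
    show (X + 1 + (j : ℚ[X]) - 1) = X + (j : ℚ[X]) by ring, nsmul_eq_mul] at h
  rw [← degree_eval_ascPochhammer j, ← h, ← C_eq_natCast,
    degree_C_mul (Nat.cast_ne_zero.2 j.factorial_ne_zero)]
  rfl

lemma chooseBasis_coeffs_unique {D : ℕ} {a b : ℕ → ℚ}
    (h : ∑ k ∈ Finset.range (D + 1), C (a k) * chooseBasis (D - k) =
      ∑ k ∈ Finset.range (D + 1), C (b k) * chooseBasis (D - k)) {k : ℕ} (hk : k ≤ D) :
    a k = b k := by
  let S : Polynomial.Sequence ℚ := ⟨chooseBasis, degree_chooseBasis⟩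
  have hflip : ∀ c : ℕ → ℚ, ∑ k ∈ Finset.range (D + 1), C (c k) * chooseBasis (D - k) =
      ∑ j ∈ Finset.range (D + 1), c (D - j) • S j := fun c => by
    rw [← Finset.sum_flip]
    refine Finset.sum_congr rfl fun k hk => ?_
    rw [Finset.mem_range] at hk
    rw [show D - (D - k) = k by omega, smul_eq_C_mul]
  rw [hflip, hflip, ← sub_eq_zero, ← Finset.sum_sub_distrib] at h
  simp only [← sub_smul] at h
  have := linearIndependent_iff'.1 S.linearIndependent _ (fun j => a (D - j) - b (D - j)) h (D - k)
    (by simp)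
  simp only [show D - (D - k) = k by omega] at this
  linarith

lemma degree_sum_chooseBasis {D : ℕ} {a : ℕ → ℚ} (h : a 0 ≠ 0) :
    (∑ k ∈ Finset.range (D + 1), C (a k) * chooseBasis (D - k)).natDegree = D := by
  refine natDegree_eq_of_degree_eq_some ?_
  have h0 : (C (a 0) * chooseBasis (D - 0)).degree = D := by
    rw [degree_C_mul h, degree_chooseBasis, Nat.sub_zero]
  rw [Finset.sum_range_succ', degree_add_eq_right_of_degree_lt, h0]
  rw [h0, ← mem_degreeLT]
  refine Submodule.sum_mem _ fun k hk => mem_degreeLT.2 ?_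
  rw [Finset.mem_range] at hk
  rw [← mem_degreeLT, ← smul_eq_C_mul]
  refine Submodule.smul_mem _ _ (mem_degreeLT.2 ?_)
  rw [degree_chooseBasis]
  exact_mod_cast (by omega : D - (k + 1) < D)

/-- In generating functions this expands `z^i = (1 - (1 - z))^i` in `z^i / (1 - z)^(c + 1)`; the
induction applies Pascal's rule on both sides. -/
lemma choose_X_add_sub (i : ℕ) : ∀ c : ℕ,
    Ring.choose ((X : ℚ[X]) + (c : ℚ[X]) - (i : ℚ[X])) c =
      ∑ j ∈ Finset.range (c + 1), C ((-1) ^ j * (i.choose j : ℚ)) * chooseBasis (c - j) := by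
  induction i with
  | zero =>
    intro c
    rw [Finset.sum_range_succ']
    simp [chooseBasis]
  | succ i ih =>
    intro c
    cases c with
    | zero => simp [chooseBasis]
    | succ c =>
      have h := Ring.choose_succ_succ ((X : ℚ[X]) + (c : ℚ[X]) - (i : ℚ[X])) c
      have h1 := ih (c + 1)
      rw [show (X : ℚ[X]) + ((c + 1 : ℕ) : ℚ[X]) - (i : ℚ[X]) = X + (c : ℚ[X]) - (i : ℚ[X]) + 1 by
        push_cast; ring] at h1
      rw [show (X : ℚ[X]) + ((c + 1 : ℕ) : ℚ[X]) - ((i + 1 : ℕ) : ℚ[X]) =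
        X + (c : ℚ[X]) - (i : ℚ[X]) by push_cast; ring, ← add_right_inj, ← h, h1, ih c,
        Finset.sum_range_succ' _ (c + 1), Finset.sum_range_succ' _ (c + 1), ← add_assoc,
        ← Finset.sum_add_distrib]
      congr 1
      · refine Finset.sum_congr rfl fun j _ => ?_
        rw [Nat.add_sub_add_right, ← add_mul, ← C_add, Nat.choose_succ_succ i j]
        congr 2
        push_cast
        ring
      · simp

lemma eq_range_card_of_lower {T : Finset ℕ} (h : ∀ n ∈ T, ∀ m < n, m ∈ T) :
    T = Finset.range T.card := by
  refine Finset.eq_of_subset_of_card_le (fun n hn => ?_) (by simp)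
  have : Finset.range (n + 1) ⊆ T := fun m hm => by
    rcases Nat.lt_succ_iff_lt_or_eq.1 (Finset.mem_range.1 hm) with hm | rfl
    exacts [h n hn m hm, hn]
  simpa [Nat.succ_le_iff] using Finset.card_le_card this

lemma sum_range_choose_eq (m j : ℕ) : ∑ i ∈ Finset.range m, i.choose j = m.choose (j + 1) := by
  induction m with
  | zero => simp
  | succ m ih => rw [Finset.sum_range_succ, ih, Nat.choose_succ_succ, add_comm]

/-- The number of terms of a Gotzmann development of degree at least `D - k`. -/
def termCount {s : ℕ} (c : Fin s → ℕ) (D k : ℕ) : ℕ :=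
  (Finset.univ.filter fun i => D ≤ c i + k).card

lemma termCount_mono {s : ℕ} (c : Fin s → ℕ) (D : ℕ) : Monotone (termCount c D) := by
  intro k l h
  refine Finset.card_le_card fun i hi => ?_
  simp only [Finset.mem_filter, Finset.mem_univ, true_and] at hi ⊢
  omega

/-- As `c` decreases, the indices selected form an initial segment of length `termCount c D l`, and
the hockey-stick identity sums over it. -/
lemma sum_choose_filter {s : ℕ} {c : Fin s → ℕ} (hc : Antitone c) (D l j : ℕ) :
    ∑ i : Fin s, (if D ≤ c i + l then (((i : ℕ).choose j : ℕ) : ℚ) else 0) =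
      ((termCount c D l).choose (j + 1) : ℕ) := by
  have hT : (Finset.univ.filter fun i => D ≤ c i + l).map Fin.valEmbedding =
      Finset.range (termCount c D l) := by
    rw [termCount, ← Finset.card_map Fin.valEmbedding]
    refine eq_range_card_of_lower fun n hn m hm => ?_
    obtain ⟨i, hi, rfl⟩ := Finset.mem_map.1 hn
    have hms : m < s := hm.trans i.2
    refine Finset.mem_map.2 ⟨⟨m, hms⟩, ?_, rfl⟩
    simp only [Finset.mem_filter, Finset.mem_univ, true_and] at hi ⊢
    have : c i ≤ c ⟨m, hms⟩ := hc (Fin.le_def.2 hm.le)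
    omega
  rw [← sum_range_choose_eq, ← hT, Finset.sum_map, ← Finset.sum_filter, Nat.cast_sum]
  rfl

/-- Summation by parts: a term located at exactly `l₀` is rewritten through the threshold conditions
`l₀ ≤ l`, the form that `sum_choose_filter` can sum. -/
lemma alternating_sum_telescope (u : ℕ → ℚ) (l₀ k : ℕ) :
    (∑ l ∈ Finset.range (k + 1), (-1) ^ (k + l) * (if l₀ ≤ l then u (k - l) else 0)) +
      ∑ l ∈ Finset.range k, (-1) ^ (k + l) * (if l₀ ≤ l then u (k - l - 1) else 0) =
    if l₀ ≤ k then (-1) ^ (k + l₀) * u (k - l₀) else 0 := by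
  have key : ∑ l ∈ Finset.range (k + 1), (if l = l₀ then (-1) ^ (k + l) * u (k - l) else 0) =
      if l₀ ≤ k then (-1) ^ (k + l₀) * u (k - l₀) else 0 := by
    rw [Finset.sum_ite_eq']
    simp
  -- After the index shift, the `l + 1` term of the first sum cancels the `l` term of the second
  -- unless `l + 1 = l₀`.
  rw [← key, Finset.sum_range_succ', Finset.sum_range_succ', add_right_comm,
    ← Finset.sum_add_distrib]
  congr 1
  · refine Finset.sum_congr rfl fun l _ => ?_
    rw [← Nat.sub_sub, ← add_assoc, pow_succ]
    split_ifs <;> first | omega | ring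
  · split_ifs <;> first | omega | ring

/-- The signed normalized coefficients of a Gotzmann development. -/
noncomputable def gotzmannCoeff (t : ℕ → ℕ) (k : ℕ) : ℚ :=
  t k + ∑ l ∈ Finset.range k, (-1) ^ (k + l) * (((t l + 1).choose (k - l + 1) : ℕ) : ℚ)

lemma sum_choose_eq_gotzmannCoeff {s : ℕ} {c : Fin s → ℕ} (hc : Antitone c) (D k : ℕ) :
    ∑ i : Fin s, (if D - c i ≤ k then (-1) ^ (k + (D - c i)) *
      (((i : ℕ).choose (k - (D - c i)) : ℕ) : ℚ) else 0) = gotzmannCoeff (termCount c D) k := by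
  have hcond : ∀ i l, D - c i ≤ l ↔ D ≤ c i + l := fun i l => by omega
  rw [Finset.sum_congr rfl fun (i : Fin s) _ => (alternating_sum_telescope
    (fun j => (((i : ℕ).choose j : ℕ) : ℚ)) (D - c i) k).symm]
  simp only [hcond]
  rw [Finset.sum_add_distrib, Finset.sum_comm, Finset.sum_comm (t := Finset.range k)]
  simp only [← Finset.mul_sum, sum_choose_filter hc]
  rw [Finset.sum_range_succ, add_right_comm, ← Finset.sum_add_distrib, gotzmannCoeff, add_comm]
  congr 1
  · simp [← two_mul]
  · refine Finset.sum_congr rfl fun l hl => ?_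
    rw [Finset.mem_range] at hl
    -- The two sums contribute `binom t_l (k - l + 1)` and `binom t_l (k - l)`; Pascal's rule merges
    -- them, which is where the `t_l + 1` comes from.
    rw [← mul_add, Nat.choose_succ_succ, show k - l - 1 + 1 = k - l by omega, Nat.cast_add,
      add_comm ((Nat.choose _ (k - l) : ℕ) : ℚ)]

lemma sum_choose_eq_sum_chooseBasis {s : ℕ} {c : Fin s → ℕ} (hc : Antitone c) {D : ℕ}
    (hD : ∀ i, c i ≤ D) :
    ∑ i : Fin s, Ring.choose ((X : ℚ[X]) + (c i : ℚ[X]) - ((i : ℕ) : ℚ[X])) (c i) =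
      ∑ k ∈ Finset.range (D + 1), C (gotzmannCoeff (termCount c D) k) * chooseBasis (D - k) := by
  simp only [← sum_choose_eq_gotzmannCoeff hc, map_sum, Finset.sum_mul]
  rw [Finset.sum_comm]
  refine Finset.sum_congr rfl fun i _ => ?_
  have hi := hD i
  rw [choose_X_add_sub]
  symm
  rw [show D + 1 = (D - c i) + (c i + 1) by omega, Finset.sum_range_add,
    Finset.sum_eq_zero, zero_add]
  · refine Finset.sum_congr rfl fun j _ => ?_
    rw [if_pos (by omega), show D - (D - c i + j) = c i - j by omega,
      show D - c i + j - (D - c i) = j by omega,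
      show D - c i + j + (D - c i) = 2 * (D - c i) + j by omega, pow_add, pow_mul]
    simp
  · intro k hk
    rw [Finset.mem_range] at hk
    rw [if_neg (by omega)]
    simp

lemma eq_sum_choose_of_eventually {s : ℕ} {c : Fin s → ℕ} {P : ℚ[X]}
    (h : ∀ᶠ n : ℕ in atTop,
      P.eval (n : ℚ) = ∑ i : Fin s, (((n + c i - (i : ℕ)).choose (c i) : ℕ) : ℚ)) :
    P = ∑ i : Fin s, Ring.choose ((X : ℚ[X]) + (c i : ℚ[X]) - ((i : ℕ) : ℚ[X])) (c i) := by
  obtain ⟨a, ha⟩ := eventually_atTop.1 (h.and (eventually_ge_atTop s))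
  refine eq_of_infinite_eval_eq _ _ (Set.Infinite.mono ?_
    (Set.infinite_range_of_injective (f := fun n : ℕ => ((n + a : ℕ) : ℚ))
      fun m n hmn => by simpa using hmn))
  rintro _ ⟨n, rfl⟩
  obtain ⟨h1, h2⟩ := ha (n + a) (by omega)
  simp only [Set.mem_ofPred_eq]
  rw [h1, eval_finsetSum]
  refine Finset.sum_congr rfl fun i _ => ?_
  rw [← coe_evalRingHom, Ring.map_choose, ← Ring.choose_natCast]
  congr 1
  have := i.2
  rw [Nat.cast_sub (by omega)]
  simp

/-! ### The polynomials `σ_j` and the bounds -/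

lemma sigma_eq (j : ℕ) : sigma j = (-1) ^ j * MvPolynomial.X j -
    ∑ k ∈ Finset.range j, (-1) ^ (j + k) * Ring.choose (sigma k + 1) (j - k + 1) := by
  rw [sigma, Finset.sum_range]

/-- The last summand of `σ_{m+1}` has sign `-1` and equals `binom (σ_m + 1) 2 = σ_m + binom σ_m 2`
up to that sign. Hence the bound for `e_{m+1}` is equivalent to `σ_m ≤ σ_{m+1}`. -/
lemma sigma_succ (m : ℕ) : sigma (m + 1) =
    (-1) ^ (m + 1) * MvPolynomial.X (m + 1) - boundPoly (m + 1) + sigma m := by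
  have h := Ring.choose_succ_succ (sigma m) 1
  rw [Ring.choose_one_right] at h
  rw [sigma_eq, Finset.sum_range_succ, boundPoly, Nat.add_sub_cancel,
    show m + 1 - m + 1 = 1 + 1 by omega, h, 
    Odd.neg_one_pow (n := m + 1 + m) ⟨m, by ring⟩]
  ring

lemma eval_sigma {t : ℕ → ℕ} {D : ℕ} {e : ℕ → ℚ}
    (h : ∀ k ≤ D, (-1) ^ k * e k = gotzmannCoeff t k) (j : ℕ) (hj : j ≤ D) :
    MvPolynomial.eval e (sigma j) = t j := by
  induction j using Nat.strong_induction_on with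
  | _ j ih =>
  have hsum : MvPolynomial.eval e
      (∑ k ∈ Finset.range j, (-1) ^ (j + k) * Ring.choose (sigma k + 1) (j - k + 1)) =
      ∑ l ∈ Finset.range j, (-1) ^ (j + l) * (((t l + 1).choose (j - l + 1) : ℕ) : ℚ) := by
    rw [map_sum]
    refine Finset.sum_congr rfl fun k hk => ?_
    rw [Finset.mem_range] at hk
    rw [map_mul, Ring.map_choose, map_add, ih k hk (by omega), ← Ring.choose_natCast]
    simp
  rw [sigma_eq, map_sub, hsum]
  have := h j hj
  simp only [map_mul, map_pow, map_neg, map_one, MvPolynomial.eval_X]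
  rw [this, gotzmannCoeff, add_sub_cancel_right]

lemma coeffBounds_of_eval_sigma {P : ℚ[X]} {e : ℕ → ℚ}
    (h : ∀ m, m + 1 ≤ P.natDegree →
      MvPolynomial.eval e (sigma m) ≤ MvPolynomial.eval e (sigma (m + 1))) :
    CoeffBounds P e := by
  have main : ∀ i, 1 ≤ i → i ≤ P.natDegree → (-1) ^ i * e i ≥ MvPolynomial.eval e (boundPoly i) := by
    intro i hi hiD
    obtain ⟨m, rfl⟩ := Nat.exists_eq_add_of_le' hi
    have := h m hiD
    rw [sigma_succ] at this
    simp only [map_add, map_sub, map_mul, map_pow, map_neg, map_one, MvPolynomial.eval_X] at this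
    linarith
  refine ⟨main, fun hD => ?_⟩
  have := main 1 le_rfl hD
  rw [boundPoly] at this
  simp only [Nat.sub_self, Finset.range_zero, Finset.sum_empty, zero_sub, map_neg,
    Ring.map_choose, sigma_eq 0, pow_zero, one_mul, sub_zero, MvPolynomial.eval_X] at this
  linarith

theorem AdmitsGotzmannDevelopment.coeffBounds {P : ℚ[X]} {e : ℕ → ℚ}
    (hP : AdmitsGotzmannDevelopment P) (he : IsHilbertSamuelCoeffs P e) : CoeffBounds P e := by
  obtain ⟨s, c, hc, h⟩ := hP
  have hPsum := eq_sum_choose_of_eventually h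
  refine coeffBounds_of_eval_sigma fun m hm => ?_
  cases s with
  | zero =>
    rw [Finset.univ_eq_empty, Finset.sum_empty] at hPsum
    rw [hPsum, natDegree_zero] at hm
    omega
  | succ s =>
    have hD : ∀ i, c i ≤ c 0 := fun i => hc (Fin.zero_le i)
    rw [sum_choose_eq_sum_chooseBasis hc hD] at hPsum
    -- The leading coefficient is `t_0`, the number of `c_i` equal to `c 0`, which is positive.
    have hdeg : P.natDegree = c 0 := by
      rw [hPsum]
      refine degree_sum_chooseBasis ?_
      rw [gotzmannCoeff, Finset.range_zero, Finset.sum_empty, add_zero, Nat.cast_ne_zero]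
      exact (Finset.card_pos.2 ⟨0, by simp⟩).ne'
    rw [hdeg] at hm
    have hcoeff : ∀ k ≤ c 0, (-1) ^ k * e k = gotzmannCoeff (termCount c (c 0)) k := fun k hk =>
      chooseBasis_coeffs_unique (a := fun k => (-1) ^ k * e k) (by
        rw [← hPsum]
        rw [IsHilbertSamuelCoeffs, hdeg] at he
        exact he.symm) hk
    rw [eval_sigma hcoeff m (by omega), eval_sigma hcoeff (m + 1) hm]
    exact_mod_cast termCount_mono c (c 0) m.le_succ

lemma choose_mem_subalgebra (T : Subalgebra ℚ (MvPolynomial ℕ ℚ)) {a : MvPolynomial ℕ ℚ}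
    (ha : a ∈ T) (n : ℕ) : Ring.choose a n ∈ T := by
  -- This makes `T` a binomial ring, so `Ring.choose` can be formed in `T` and mapped out.
  let _ : Module ℚ≥0 T := Module.compHom T (NNRat.castHom ℚ)
  have := Ring.map_choose T.val (⟨a, ha⟩ : T) n
  rw [Subalgebra.coe_val] at this
  rw [← this]
  exact Subtype.property _

lemma sigma_mem_supported (j : ℕ) :
    sigma j ∈ MvPolynomial.supported ℚ (Finset.range (j + 1) : Set ℕ) := by
  induction j using Nat.strong_induction_on with
  | _ j ih =>
  rw [sigma_eq]
  refine sub_mem (mul_mem (pow_mem (neg_mem (one_mem _)) _)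
    (MvPolynomial.X_mem_supported.2 (by simp))) (sum_mem fun k hk => mul_mem
      (pow_mem (neg_mem (one_mem _)) _) (choose_mem_subalgebra _ (add_mem ?_ (one_mem _)) _))
  rw [Finset.mem_range] at hk
  exact MvPolynomial.supported_mono (by simpa using by omega) (ih k hk)

theorem vars_boundPoly_subset (i : ℕ) (hi : 1 ≤ i) :
    (boundPoly i).vars ⊆ Finset.range i := by
  have hsig : ∀ k < i, sigma k ∈ MvPolynomial.supported ℚ (Finset.range i : Set ℕ) := fun k hk =>
    MvPolynomial.supported_mono (by simpa using by omega) (sigma_mem_supported k)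
  rw [← Finset.coe_subset, ← MvPolynomial.mem_supported, boundPoly]
  refine sub_mem (sum_mem fun k hk => mul_mem (pow_mem (neg_mem (one_mem _)) _)
    (choose_mem_subalgebra _ (add_mem (hsig k ?_) (one_mem _)) _))
    (choose_mem_subalgebra _ (hsig (i - 1) (by omega)) _)
  rw [Finset.mem_range] at hk
  omega

end HilbertBounds

/-! ### Standard algebras and primary ideals -/

namespace HilbertBounds

open Filter

section Standard

variable {R S : Type*} [CommRing R] [CommRing S] [Algebra R S] {r : ℕ}

@[simp] lemma monomialIn_single (x : Fin r → S) (i : Fin r) (k : ℕ) :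
    monomialIn x (Finsupp.single i k) = x i ^ k := by
  simp [monomialIn]

lemma monomialIn_mem_graded {𝒜 : ℕ → Submodule R S} [SetLike.GradedMonoid 𝒜] {x : Fin r → S}
    (hx : ∀ i, x i ∈ 𝒜 1) (α : Fin r →₀ ℕ) : monomialIn x α ∈ 𝒜 α.degree := by
  induction α using Finsupp.induction_linear with
  | zero => simpa using SetLike.GradedOne.one_mem
  | add α β hα hβ =>
    rw [monomialIn_add, map_add]
    exact SetLike.GradedMul.mul_mem hα hβ
  | single i k =>
    have := SetLike.pow_mem_graded k (hx i)
    rw [monomialIn_single, Finsupp.degree_single]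
    simpa using this

lemma adjoin_range_eq_span_monomialIn (x : Fin r → S) :
    Subalgebra.toSubmodule (Algebra.adjoin R (Set.range x)) =
      Submodule.span R (Set.range (monomialIn x)) := by
  refine le_antisymm ?_ (Submodule.span_le.2 ?_)
  · rw [Algebra.adjoin_eq_span]
    refine Submodule.span_mono fun y hy => ?_
    induction hy using Submonoid.closure_induction with
    | mem y hy =>
      obtain ⟨i, rfl⟩ := hy
      exact ⟨Finsupp.single i 1, by simp⟩
    | one => exact ⟨0, monomialIn_zero x⟩
    | mul y z _ _ hy hz =>
      obtain ⟨α, rfl⟩ := hy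
      obtain ⟨β, rfl⟩ := hz
      exact ⟨α + β, monomialIn_add x α β⟩
  · rintro _ ⟨α, rfl⟩
    refine (Subalgebra.mem_toSubmodule _).2 (prod_mem fun i _ => ?_)
    exact pow_mem (Algebra.subset_adjoin (Set.mem_range_self i)) _

/-- Monomials span `S` and are homogeneous, so projecting to degree `n` keeps exactly those of
degree `n`. -/
lemma graded_eq_span_monomialIn {𝒜 : ℕ → Submodule R S} [GradedAlgebra 𝒜] {x : Fin r → S}
    (hx : ∀ i, x i ∈ 𝒜 1) (hgen : Algebra.adjoin R (Set.range x) = ⊤) (n : ℕ) :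
    𝒜 n = Submodule.span R (monomialIn x '' {β | β.degree = n}) := by
  refine le_antisymm (fun y hy => ?_) (Submodule.span_le.2 ?_)
  · have hall : ∀ z : S, GradedAlgebra.proj 𝒜 n z ∈
        Submodule.span R (monomialIn x '' {β | β.degree = n}) := by
      intro z
      have hz : z ∈ Submodule.span R (Set.range (monomialIn x)) := by
        rw [← adjoin_range_eq_span_monomialIn, hgen]
        trivial
      induction hz using Submodule.span_induction with
      | mem z hz =>
        obtain ⟨α, rfl⟩ := hz
        rw [GradedAlgebra.proj_apply]
        by_cases h : α.degree = n
        · subst h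
          rw [DirectSum.decompose_of_mem_same _ (monomialIn_mem_graded hx α)]
          exact Submodule.subset_span ⟨α, rfl, rfl⟩
        · rw [DirectSum.decompose_of_mem_ne _ (monomialIn_mem_graded hx α) h]
          exact zero_mem _
      | zero => simp
      | add y z _ _ hy hz => rw [map_add]; exact add_mem hy hz
      | smul c z _ hz => rw [map_smul]; exact Submodule.smul_mem _ _ hz
    have := hall y
    rwa [GradedAlgebra.proj_apply, DirectSum.decompose_of_mem_same _ hy] at this
  · rintro _ ⟨α, rfl, rfl⟩
    exact monomialIn_mem_graded hx α

theorem IsStandardAlgebra.admitsGotzmannDevelopment [IsArtinianRing R] {𝒜 : ℕ → Submodule R S}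
    [GradedAlgebra 𝒜] (h𝒜 : IsStandardAlgebra R 𝒜) {P : Polynomial ℚ}
    (hP : IsHilbertPolynomial P (hilbertFunction R 𝒜)) : AdmitsGotzmannDevelopment P := by
  have hfg : (𝒜 1).FG := Module.Finite.iff_fg.1 h𝒜.finite_degree_one
  obtain ⟨r, x, hx⟩ := Submodule.fg_iff_exists_fin_generating_family.1 hfg
  have hx1 : ∀ i, x i ∈ 𝒜 1 := fun i => hx ▸ Submodule.subset_span ⟨i, rfl⟩
  have hgen : Algebra.adjoin R (Set.range x) = ⊤ := by
    rw [← h𝒜.generated, ← hx, Algebra.adjoin_span]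
  refine admitsGotzmannDevelopment_of_length x (fun _ => ⊥) 𝒜 ?_ ?_ ?_ hP ?_
  · intro γ n w hw
    rw [(Submodule.mem_bot R).1 hw, mul_zero]
    exact zero_mem _
  · intro n
    rw [bot_sup_eq]
    exact graded_eq_span_monomialIn hx1 hgen n
  · exact Module.length_ne_top
  · intro n
    rw [hilbertFunction, (Submodule.quotEquivOfEqBot ((⊥ : Submodule R S).submoduleOf (𝒜 n))
      (by rw [Submodule.submoduleOf, Submodule.comap_bot, Submodule.ker_subtype])).length_eq]

end Standard

section Ideal

variable {A : Type*} [CommRing A] {r : ℕ}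

lemma monomialIn_mem_pow {𝔞 : Ideal A} {x : Fin r → A} (hx : ∀ i, x i ∈ 𝔞) (α : Fin r →₀ ℕ) :
    monomialIn x α ∈ 𝔞 ^ α.degree := by
  induction α using Finsupp.induction_linear with
  | zero => simp
  | add α β hα hβ =>
    rw [monomialIn_add, map_add, pow_add]
    exact Ideal.mul_mem_mul hα hβ
  | single i k =>
    rw [monomialIn_single, Finsupp.degree_single]
    exact Ideal.pow_mem_pow (hx i) k

lemma pow_span_range_le (x : Fin r → A) (n : ℕ) :
    Ideal.span (Set.range x) ^ n ≤ Ideal.span (monomialIn x '' {β | β.degree = n}) := by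
  induction n with
  | zero =>
    rw [pow_zero, Ideal.one_eq_top, top_le_iff, Ideal.eq_top_iff_one]
    exact Ideal.subset_span ⟨0, by simp, monomialIn_zero x⟩
  | succ n ih =>
    rw [pow_succ]
    refine (Ideal.mul_mono_left ih).trans ?_
    rw [Ideal.span_mul_span', Ideal.span_le]
    rintro _ ⟨_, ⟨β, rfl, rfl⟩, _, ⟨i, rfl⟩, rfl⟩
    refine Ideal.subset_span ⟨β + Finsupp.single i 1, ?_, ?_⟩
    · simp
    · simp [monomialIn_add]

/-- Some power of the maximal ideal lies in `𝔞`, so `A ⧸ 𝔞` is Noetherian local with nilpotent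
maximal ideal, hence Artinian. -/
lemma length_quotient_ne_top [IsNoetherianRing A] [IsLocalRing A] {𝔞 : Ideal A}
    (h : 𝔞.radical = IsLocalRing.maximalIdeal A) : Module.length A (A ⧸ 𝔞) ≠ ⊤ := by
  have hne : 𝔞 ≠ ⊤ := by
    rintro rfl
    rw [Ideal.radical_top] at h
    exact Ideal.IsPrime.ne_top' h.symm
  have : Nontrivial (A ⧸ 𝔞) := Ideal.Quotient.nontrivial_iff.2 hne
  have : IsLocalRing (A ⧸ 𝔞) :=
    IsLocalRing.of_surjective' (Ideal.Quotient.mk 𝔞) Ideal.Quotient.mk_surjective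
  obtain ⟨k, hk⟩ := Ideal.exists_radical_pow_le_of_fg 𝔞 (IsNoetherian.noetherian _)
  have hart : IsArtinianRing (A ⧸ 𝔞) := by
    rw [isArtinianRing_iff_isNilpotent_maximalIdeal]
    refine ⟨k, ?_⟩
    have hle : IsLocalRing.maximalIdeal (A ⧸ 𝔞) ≤
        (IsLocalRing.maximalIdeal A).map (Ideal.Quotient.mk 𝔞) := by
      intro y hy
      obtain ⟨a, rfl⟩ := Ideal.Quotient.mk_surjective y
      refine Ideal.mem_map_of_mem _ ((IsLocalRing.mem_maximalIdeal _).2 fun ha => ?_)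
      exact (IsLocalRing.mem_maximalIdeal _).1 hy (ha.map _)
    rw [Ideal.zero_eq_bot, eq_bot_iff]
    refine (Ideal.pow_right_mono hle k).trans ?_
    rw [← Ideal.map_pow, ← h]
    refine (Ideal.map_mono hk).trans ?_
    rw [Ideal.map_quotient_self]
  rw [Module.length_eq_of_surjective (S := A) (R := A ⧸ 𝔞) Ideal.Quotient.mk_surjective]
  exact Module.length_ne_top

theorem admitsGotzmannDevelopment_of_ideal [IsNoetherianRing A] [IsLocalRing A] {𝔞 : Ideal A}
    (h𝔞 : 𝔞.radical = IsLocalRing.maximalIdeal A) {P : Polynomial ℚ}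
    (hP : IsHilbertPolynomial P (idealHilbertFunction 𝔞)) : AdmitsGotzmannDevelopment P := by
  obtain ⟨r, x, hx⟩ := Submodule.fg_iff_exists_fin_generating_family.1
    (IsNoetherian.noetherian 𝔞)
  have hx1 : ∀ i, x i ∈ 𝔞 := fun i => hx ▸ Submodule.subset_span ⟨i, rfl⟩
  -- The associated graded ring is never formed: lengths are taken over `A` inside the `𝔞`-adic
  -- filtration.
  refine admitsGotzmannDevelopment_of_length (R := A) x (fun n => 𝔞 ^ (n + 1)) (fun n => 𝔞 ^ n)
    ?_ ?_ ?_ hP fun n => rfl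
  · intro γ n w hw
    rw [add_assoc, pow_add]
    exact Ideal.mul_mem_mul (monomialIn_mem_pow hx1 γ) hw
  · intro n
    refine le_antisymm ?_ (sup_le (Ideal.pow_le_pow_right n.le_succ) (Submodule.span_le.2 ?_))
    · refine le_trans ?_ le_sup_right
      have := pow_span_range_le x n
      rwa [show Ideal.span (Set.range x) = 𝔞 from hx] at this
    · rintro _ ⟨α, rfl, rfl⟩
      exact monomialIn_mem_pow hx1 α
  · have : Submodule.comap (Algebra.linearMap A A) (𝔞 ^ (0 + 1)) = 𝔞 := by
      rw [zero_add, pow_one]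
      rfl
    rw [this]
    exact length_quotient_ne_top h𝔞

end Ideal

end HilbertBounds

theorem corollary3p14 :
    -- the bounding polynomial `fᵢ` involves only `e₀, …, e_{i-1}`
    (∀ i : ℕ, 1 ≤ i → (HilbertBounds.boundPoly i).vars ⊆ Finset.range i) ∧
    -- polynomials admitting a Gotzmann development
    (∀ (P : Polynomial ℚ) (e : ℕ → ℚ), HilbertBounds.AdmitsGotzmannDevelopment P →
      HilbertBounds.IsHilbertSamuelCoeffs P e → HilbertBounds.CoeffBounds P e) ∧
    -- Hilbert polynomials of standard algebras over Artinian equicharacteristic local rings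
    (∀ (R₀ : Type*) (S : Type*) [CommRing R₀] [IsArtinianRing R₀] [IsLocalRing R₀]
      [CommRing S] [Algebra R₀ S] (𝒜 : ℕ → Submodule R₀ S) [GradedAlgebra 𝒜]
      (P : Polynomial ℚ) (e : ℕ → ℚ),
      HilbertBounds.IsEquicharacteristic R₀ → HilbertBounds.IsStandardAlgebra R₀ 𝒜 →
      HilbertBounds.IsHilbertPolynomial P (HilbertBounds.hilbertFunction R₀ 𝒜) →
      HilbertBounds.IsHilbertSamuelCoeffs P e → HilbertBounds.CoeffBounds P e) ∧
    -- Hilbert polynomials of ideals primary to the maximal ideal of a local ring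
    (∀ (A : Type*) [CommRing A] [IsNoetherianRing A] [IsLocalRing A] (𝔞 : Ideal A)
      (P : Polynomial ℚ) (e : ℕ → ℚ),
      𝔞.radical = IsLocalRing.maximalIdeal A → HilbertBounds.IsEquicharacteristic (A ⧸ 𝔞) →
      HilbertBounds.IsHilbertPolynomial P (HilbertBounds.idealHilbertFunction 𝔞) →
      HilbertBounds.IsHilbertSamuelCoeffs P e → HilbertBounds.CoeffBounds P e) := by
  refine ⟨HilbertBounds.vars_boundPoly_subset, fun P e hP he => hP.coeffBounds he, ?_, ?_⟩
  · intro R₀ S _ _ _ _ _ 𝒜 _ P e _ h𝒜 hP he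
    exact (h𝒜.admitsGotzmannDevelopment hP).coeffBounds he
  · intro A _ _ _ 𝔞 P e h𝔞 _ hP he
    exact (HilbertBounds.admitsGotzmannDevelopment_of_ideal h𝔞 hP).coeffBounds he
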